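/- Let $\rho$ be a density matrix on $\mathbb C^d$ (positive semidefinite, trace one). Let $\lambda_1,\dots,\lambda_{d^2-1}$ be traceless Hermitian $d\times d$ matrices with $\operatorname{Tr}[\lambda_\alpha\lambda_\beta]=2\delta_{\alpha\beta}$. Let $\mathbf\Pi^{(j)}=\{\Pi^{(j)}_m\}_{m=1}^{M^{(j)}}$, $j=1,\dots,J$, be POVMs on $\mathbb C^d$ which together are informationally complete, i.e. the matrices $\Pi^{(j)}_m$ span the real vector space of Hermitian $d\times d$ matrices. Measure $\mathbf\Pi^{(j)}$ on $n^{(j)}\ge 1$ copies of $\rho$, all $N=\sum_j n^{(j)}$ trials being independent, where a trial of $\mathbf\Pi^{(j)}$ gives outcome $m$ with probability $\operatorname{Tr}[\Pi^{(j)}_m\rho]$. Let $\mathbf f_N$ be the vector whose $(j,m)$ entry is the relative frequency of outcome $m$ among the $n^{(j)}$ trials of $\mathbf\Pi^{(j)}$, and for a Hermitian matrix $\sigma$ let $\mathbf p(\sigma)$ be the vector with $(j,m)$ entry $\operatorname{Tr}[\Pi^{(j)}_m\sigma]$. Let $A$ be the real matrix with entries $A_{(j,m),\alpha}=\tfrac12\operatorname{Tr}[\Pi^{(j)}_m\lambda_\alpha]$,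 let $A_L^{-1}=(A^TA)^{-1}A^T$, and let $\|A\|_{\max}$ and $\|A\|_{\min}$ be the maximum and the minimum of $\|A\mathbf v\|_2/\|\mathbf v\|_2$ over $\mathbf v\ne\mathbf 0$. Put $$c_\alpha=\sum_{j=1}^J\frac{N}{n^{(j)}}\Bigl\{\max_m [A_L^{-1}]_{\alpha,(j,m)}-\min_m [A_L^{-1}]_{\alpha,(j,m)}\Bigr\}^2 .$$ Let $\Delta$ be one of the loss functions $$\Delta^{\mathrm{HS}}(\rho',\rho)=\tfrac1{\sqrt2}\operatorname{Tr}[(\rho'-\rho)^2]^{1/2},\qquad \Delta^{\mathrm T}(\rho',\rho)=\tfrac12\operatorname{Tr}|\rho'-\rho|,\qquad \Delta^{\mathrm{IF}}(\rho',\rho)=1-\Bigl(\operatorname{Tr}\sqrt{\sqrt{\rho'}\,\rho\,\sqrt{\rho'}}\Bigr)^2,$$ and correspondingly let $b=\frac{8}{d^2-1}$, $b=\frac{16}{d(d^2-1)}$, $b=\frac{4}{d(d^2-1)}$. (For $d=1$ the sums over $\alpha$ below are empty.) **Theorem 2 (confidence level of the CLS estimator).** For every real vector $\mathbf f$ there is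 a unique density matrix minimising $\|\mathbf p(\rho')-\mathbf f\|_2$ over all density matrices $\rho'$; let $\rho^{\mathrm{CLS}}_N$ be the minimiser for $\mathbf f=\mathbf f_N$. Then, for every $\delta>0$, $$\Delta(\rho^{\mathrm{CLS}}_N,\rho)\le\delta$$ holds with probability at least $$CL^{\mathrm{CLS}}=1-2\sum_{\alpha=1}^{d^2-1}\exp\Bigl[-\Bigl(\frac{\|A\|_{\min}}{\|A\|_{\max}}\Bigr)^2\frac{b}{c_\alpha}\,\delta^2N\Bigr].$$ Moreover $CL^{\mathrm{CLS}}\le CL^{\mathrm{ENM}}$, where $CL^{\mathrm{ENM}}=1-2\sum_{\alpha=1}^{d^2-1}\exp\bigl[-\frac{b}{c_\alpha}\delta^2N\bigr]$ is the confidence level of the extended norm-minimization (ENM) estimator. -/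

import Mathlib

open MeasureTheory ProbabilityTheory
open scoped MatrixOrder ComplexOrder

noncomputable section

namespace QTomo

/-- Density matrices on `ℂ^d`: positive-semidefinite matrices of trace one. -/
def IsDensityMatrix {d : ℕ} (ρ : Matrix (Fin d) (Fin d) ℂ) : Prop :=
  ρ.PosSemidef ∧ ρ.trace = 1

/-- A positive operator-valued measure with finitely many outcomes. -/
def IsPOVM {d M : ℕ} (E : Fin M → Matrix (Fin d) (Fin d) ℂ) : Prop :=
  (∀ m, (E m).PosSemidef) ∧ ∑ m, E m = 1

/-- A finite family of POVMs is informationally complete if its elements span the real vector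
space of all Hermitian matrices. -/
def IsInformationallyComplete {d J : ℕ} {M : Fin J → ℕ}
    (E : (j : Fin J) → Fin (M j) → Matrix (Fin d) (Fin d) ℂ) : Prop :=
  Submodule.span ℝ {X | ∃ j, ∃ m, X = E j m} =
    selfAdjoint.submodule ℝ (Matrix (Fin d) (Fin d) ℂ)

/-- A set of `d ^ 2 - 1` Hermitian, traceless matrices with `Tr (l α * l β) = 2 δ_{αβ}`. -/
def IsBlochBasis {d : ℕ} (l : Fin (d ^ 2 - 1) → Matrix (Fin d) (Fin d) ℂ) : Prop :=
  (∀ α, (l α).IsHermitian) ∧ (∀ α, (l α).trace = 0) ∧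
    ∀ α β, (l α * l β).trace = if α = β then 2 else 0

/-- Index set of all pairs `(j, m)`: measurement `j`, outcome `m`. -/
abbrev Outcome {J : ℕ} (M : Fin J → ℕ) : Type := Σ j : Fin J, Fin (M j)

/-- The Born probability `Tr (E σ)`. It is real for Hermitian `E` and `σ`. -/
def born {d : ℕ} (E σ : Matrix (Fin d) (Fin d) ℂ) : ℝ := (E * σ).trace.re

/-- The vector `p(σ)` of all Born probabilities, in Euclidean space. -/
def probVec {d J : ℕ} {M : Fin J → ℕ} (E : (j : Fin J) → Fin (M j) → Matrix (Fin d) (Fin d) ℂ)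
    (σ : Matrix (Fin d) (Fin d) ℂ) : EuclideanSpace ℝ (Outcome M) :=
  WithLp.toLp 2 fun i => born (E i.1 i.2) σ

/-- The vector of relative frequencies of the data `x`, where `x j q` is the outcome of the
`q`-th trial of the measurement `j`. -/
def freqVec {J : ℕ} {M n : Fin J → ℕ} (x : (j : Fin J) → Fin (n j) → Fin (M j)) :
    EuclideanSpace ℝ (Outcome M) :=
  WithLp.toLp 2 fun i =>
    ((Finset.univ.filter fun q : Fin (n i.1) => x i.1 q = i.2).card : ℝ) / (n i.1 : ℝ)

/-- `ρ'` is a constrained least-squares estimate for the frequency vector `f`: a density matrix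
minimising `‖p(ρ') - f‖₂` among all density matrices. -/
def IsCLSEstimate {d J : ℕ} {M : Fin J → ℕ}
    (E : (j : Fin J) → Fin (M j) → Matrix (Fin d) (Fin d) ℂ)
    (f : EuclideanSpace ℝ (Outcome M)) (ρ' : Matrix (Fin d) (Fin d) ℂ) : Prop :=
  IsDensityMatrix ρ' ∧
    ∀ σ : Matrix (Fin d) (Fin d) ℂ, IsDensityMatrix σ →
      ‖probVec E ρ' - f‖ ≤ ‖probVec E σ - f‖

/-- The matrix `A` with entries `Tr (E_{j,m} l_α) / 2`. -/
def designMatrix {d J : ℕ} {M : Fin J → ℕ}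
    (E : (j : Fin J) → Fin (M j) → Matrix (Fin d) (Fin d) ℂ)
    (l : Fin (d ^ 2 - 1) → Matrix (Fin d) (Fin d) ℂ) :
    Matrix (Outcome M) (Fin (d ^ 2 - 1)) ℝ :=
  Matrix.of fun i α => (E i.1 i.2 * l α).trace.re / 2

/-- The left inverse `(Aᵀ A)⁻¹ Aᵀ`. -/
def leftInv {ι κ : Type*} [Fintype ι] [Fintype κ] [DecidableEq κ] (A : Matrix ι κ ℝ) :
    Matrix κ ι ℝ :=
  (A.transpose * A)⁻¹ * A.transpose

/-- The ratio `‖A v‖₂ / ‖v‖₂`. -/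
def stretch {ι κ : Type*} [Fintype ι] [Fintype κ] (A : Matrix ι κ ℝ)
    (v : EuclideanSpace ℝ κ) : ℝ :=
  ‖(WithLp.toLp 2 (A.mulVec v.ofLp) : EuclideanSpace ℝ ι)‖ / ‖v‖

/-- `‖A‖_max`, the largest value of `‖A v‖₂ / ‖v‖₂` over `v ≠ 0`. -/
def normMax {ι κ : Type*} [Fintype ι] [Fintype κ] (A : Matrix ι κ ℝ) : ℝ :=
  sSup {t | ∃ v : EuclideanSpace ℝ κ, v ≠ 0 ∧ t = stretch A v}

/-- `‖A‖_min`, the smallest value of `‖A v‖₂ / ‖v‖₂` over `v ≠ 0`. -/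
def normMin {ι κ : Type*} [Fintype ι] [Fintype κ] (A : Matrix ι κ ℝ) : ℝ :=
  sInf {t | ∃ v : EuclideanSpace ℝ κ, v ≠ 0 ∧ t = stretch A v}

/-- `c_α = ∑_j (N / n_j) (max_m B_{α,(j,m)} - min_m B_{α,(j,m)})²`, with `B` the left inverse of
`A` and `N = ∑_j n_j`. -/
def cCoeff {J : ℕ} {κ : Type*} [Fintype κ] [DecidableEq κ] {M : Fin J → ℕ} (n : Fin J → ℕ)
    (A : Matrix (Outcome M) κ ℝ) (α : κ) : ℝ :=
  ∑ j, (((∑ i, n i : ℕ) : ℝ) / (n j : ℝ)) *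
    ((⨆ m : Fin (M j), leftInv A α ⟨j, m⟩) - ⨅ m : Fin (M j), leftInv A α ⟨j, m⟩) ^ 2

/-- The three loss functions: Hilbert-Schmidt distance, trace distance, infidelity. -/
inductive Loss
  | hilbertSchmidt
  | traceDistance
  | infidelity

/-- The value `Δ(ρ', ρ)` of a loss function. -/
def Loss.val {d : ℕ} : Loss → Matrix (Fin d) (Fin d) ℂ → Matrix (Fin d) (Fin d) ℂ → ℝ
  | .hilbertSchmidt, ρ', ρ => 1 / Real.sqrt 2 * Real.sqrt (((ρ' - ρ) ^ 2).trace.re)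
  | .traceDistance, ρ', ρ => 1 / 2 * (CFC.abs (ρ' - ρ)).trace.re
  | .infidelity, ρ', ρ =>
      1 - (CFC.sqrt (CFC.sqrt ρ' * ρ * CFC.sqrt ρ')).trace.re ^ 2

/-- The constant `b` attached to a loss function in dimension `d`. -/
def Loss.b (d : ℕ) : Loss → ℝ
  | .hilbertSchmidt => 8 / ((d : ℝ) ^ 2 - 1)
  | .traceDistance => 16 / ((d : ℝ) * ((d : ℝ) ^ 2 - 1))
  | .infidelity => 4 / ((d : ℝ) * ((d : ℝ) ^ 2 - 1))

/-- The ENM confidence level `1 - 2 ∑_α exp (-(b / c_α) δ² N)`. -/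
def confLevelENM {d J : ℕ} {M : Fin J → ℕ} (L : Loss) (n : Fin J → ℕ)
    (E : (j : Fin J) → Fin (M j) → Matrix (Fin d) (Fin d) ℂ)
    (l : Fin (d ^ 2 - 1) → Matrix (Fin d) (Fin d) ℂ) (δ : ℝ) : ℝ :=
  1 - 2 * ∑ α, Real.exp
    (-(L.b d / cCoeff n (designMatrix E l) α * δ ^ 2 * ((∑ j, n j : ℕ) : ℝ)))

/-- The CLS confidence level `1 - 2 ∑_α exp (-(‖A‖_min / ‖A‖_max)² (b / c_α) δ² N)`. -/
def confLevelCLS {d J : ℕ} {M : Fin J → ℕ} (L : Loss) (n : Fin J → ℕ)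
    (E : (j : Fin J) → Fin (M j) → Matrix (Fin d) (Fin d) ℂ)
    (l : Fin (d ^ 2 - 1) → Matrix (Fin d) (Fin d) ℂ) (δ : ℝ) : ℝ :=
  1 - 2 * ∑ α, Real.exp
    (-((normMin (designMatrix E l) / normMax (designMatrix E l)) ^ 2 *
      (L.b d / cCoeff n (designMatrix E l) α) * δ ^ 2 * ((∑ j, n j : ℕ) : ℝ)))

end QTomo

end

/-! Differences of density matrices are determined by their Bloch vectors, and p(ρ') - p(ρ) = A(s' -
s). The set of vectors p(σ) is convex and compact, and the CLS estimate is the projection of f onto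
it. Put z = A_L⁻¹(f - p(ρ)), so that Az is the orthogonal projection of f - p(ρ) onto the range of
A. The obtuse-angle inequality of the convex projection, tested at the true state, gives ‖A(s' -
s)‖² ≤ ⟨Az, A(s' - s)⟩, hence ‖A(s' - s)‖ ≤ ‖Az‖. With r = ‖A‖_min/‖A‖_max this yields r‖s' - s‖ ≤
‖z‖ (`IsCLSEstimate.ratio_mul_norm_le`).

Each loss is at most K‖s' - s‖ (`Loss.val_le`); only the infidelity needs real work, through a
Powers–Størmer type bound. A loss above δ therefore forces some coordinate of z to reach rδ/(K√(d² -
1)) in absolute value. Each coordinate is a centred sum of independent bounded terms, one per trial,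
so Hoeffding (`measureReal_abs_freq_ge_le`) and a union bound finish; b is exactly 2/(K²(d² - 1)).
The comparison with ENM is just r ≤ 1. -/

namespace QTomo

/-! ### Bounding the losses by the Frobenius norm -/

section MatrixInequalities

variable {d : ℕ}

lemma trace_conjTranspose_mul_self_re (X : Matrix (Fin d) (Fin d) ℂ) :
    (X.conjTranspose * X).trace.re = ∑ i, ∑ j, ‖X j i‖ ^ 2 := by
  simp only [Matrix.trace, Matrix.diag_apply, Matrix.mul_apply, Matrix.conjTranspose_apply,
    Complex.re_sum]
  refine Finset.sum_congr rfl fun i _ => Finset.sum_congr rfl fun j _ => ?_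
  rw [Complex.star_def, mul_comm, Complex.mul_conj, Complex.ofReal_re, Complex.normSq_eq_norm_sq]

lemma sum_norm_diag_le (X : Matrix (Fin d) (Fin d) ℂ) :
    ∑ i, ‖X i i‖ ≤ Real.sqrt d * Real.sqrt (X.conjTranspose * X).trace.re := by
  rw [← Real.sqrt_mul (Nat.cast_nonneg d)]
  apply Real.le_sqrt_of_sq_le
  have h := sq_sum_le_card_mul_sum_sq (s := (Finset.univ : Finset (Fin d)))
    (f := fun i => ‖X i i‖)
  rw [Finset.card_univ, Fintype.card_fin] at h
  refine h.trans (mul_le_mul_of_nonneg_left ?_ (Nat.cast_nonneg d))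
  rw [trace_conjTranspose_mul_self_re]
  exact Finset.sum_le_sum fun i _ =>
    Finset.single_le_sum (f := fun j => ‖X j i‖ ^ 2) (fun j _ => sq_nonneg _) (Finset.mem_univ i)

/-- Unitary diagonalisation of a Hermitian matrix. -/
lemma exists_unitary_diagonal {H : Matrix (Fin d) (Fin d) ℂ} (hH : H.IsHermitian) :
    ∃ (U : Matrix (Fin d) (Fin d) ℂ) (h : Fin d → ℝ),
      U * U.conjTranspose = 1 ∧ U.conjTranspose * H * U = Matrix.diagonal fun i => (h i : ℂ) := by
  refine ⟨hH.eigenvectorUnitary, hH.eigenvalues, ?_, ?_⟩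
  · exact Unitary.mul_star_self_of_mem hH.eigenvectorUnitary.2
  · have := hH.conjStarAlgAut_star_eigenvectorUnitary
    rw [Unitary.conjStarAlgAut_star_apply] at this
    exact this

lemma trace_unitary_conj {U : Matrix (Fin d) (Fin d) ℂ} (hU : U * U.conjTranspose = 1)
    (X : Matrix (Fin d) (Fin d) ℂ) : (U.conjTranspose * X * U).trace = X.trace := by
  rw [Matrix.trace_mul_comm, ← mul_assoc, hU, one_mul]

lemma unitary_conj_mul {U : Matrix (Fin d) (Fin d) ℂ} (hU : U * U.conjTranspose = 1)
    (X Y : Matrix (Fin d) (Fin d) ℂ) :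
    (U.conjTranspose * X * U) * (U.conjTranspose * Y * U) = U.conjTranspose * (X * Y) * U := by
  calc (U.conjTranspose * X * U) * (U.conjTranspose * Y * U)
      = U.conjTranspose * X * (U * U.conjTranspose) * (Y * U) := by simp only [mul_assoc]
    _ = U.conjTranspose * (X * Y) * U := by rw [hU]; simp only [mul_assoc, mul_one]

lemma conjTranspose_unitary_conj (U X : Matrix (Fin d) (Fin d) ℂ) :
    (U.conjTranspose * X * U).conjTranspose = U.conjTranspose * X.conjTranspose * U := by
  simp [Matrix.conjTranspose_mul, mul_assoc]

/-- Here `H` is |X|. In an eigenbasis of `H`, column i of `X` has norm equal to the i-th eigenvalue,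
which dominates the diagonal entry. -/
lemma re_trace_le_of_sq_eq {X H : Matrix (Fin d) (Fin d) ℂ} (hH : H.PosSemidef)
    (hsq : H * H = X.conjTranspose * X) : X.trace.re ≤ H.trace.re := by
  obtain ⟨U, h, hU, hdiag⟩ := exists_unitary_diagonal hH.1
  have hh : ∀ i, 0 ≤ h i := by
    have hp := hH.conjTranspose_mul_mul_same U
    rw [hdiag, Matrix.posSemidef_diagonal_iff] at hp
    intro i
    exact_mod_cast hp i
  set X' := U.conjTranspose * X * U with hX'
  have hcol : X'.conjTranspose * X' = Matrix.diagonal fun i => ((h i ^ 2 : ℝ) : ℂ) := by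
    rw [hX', conjTranspose_unitary_conj, unitary_conj_mul hU, ← hsq, ← unitary_conj_mul hU, hdiag,
      Matrix.diagonal_mul_diagonal]
    congr 1; ext i; push_cast; ring
  rw [← trace_unitary_conj hU X, ← trace_unitary_conj hU H, hdiag, Matrix.trace_diagonal,
    ← hX', Matrix.trace, Complex.re_sum, Complex.re_sum]
  refine Finset.sum_le_sum fun i _ => ?_
  rw [Matrix.diag_apply, Complex.ofReal_re]
  refine (Complex.re_le_norm _).trans ((pow_le_pow_iff_left₀ (norm_nonneg _) (hh i) two_ne_zero).1 ?_)
  have hi : ∑ j, ‖X' j i‖ ^ 2 = h i ^ 2 := by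
    have := congrArg Complex.re (congrFun (congrFun hcol i) i)
    rw [Matrix.diagonal_apply_eq, Complex.ofReal_re, Matrix.mul_apply, Complex.re_sum] at this
    rw [← this]
    refine Finset.sum_congr rfl fun j _ => ?_
    rw [Matrix.conjTranspose_apply, Complex.star_def, mul_comm, Complex.mul_conj,
      Complex.ofReal_re, Complex.normSq_eq_norm_sq]
  rw [← hi]
  exact Finset.single_le_sum (f := fun j => ‖X' j i‖ ^ 2) (fun j _ => sq_nonneg _)
    (Finset.mem_univ i)

/-- A Powers–Størmer type inequality with the Frobenius norm on the right-hand side. -/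
lemma trace_sub_sq_le {A B : Matrix (Fin d) (Fin d) ℂ} (hA : A.PosSemidef) (hB : B.PosSemidef) :
    ((A - B) * (A - B)).trace.re ≤ Real.sqrt d *
      Real.sqrt ((A * A - B * B).conjTranspose * (A * A - B * B)).trace.re := by
  obtain ⟨U, c, hU, hdiag⟩ := exists_unitary_diagonal (hA.1.sub hB.1)
  set A' := U.conjTranspose * A * U with hA'
  set B' := U.conjTranspose * B * U with hB'
  have hAd : ∀ i, 0 ≤ (A' i i).re := fun i =>
    (Complex.le_def.1 ((hA.conjTranspose_mul_mul_same U).diag_nonneg (i := i))).1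
  have hBd : ∀ i, 0 ≤ (B' i i).re := fun i =>
    (Complex.le_def.1 ((hB.conjTranspose_mul_mul_same U).diag_nonneg (i := i))).1
  have hAB : A' = B' + Matrix.diagonal fun i => (c i : ℂ) := by
    rw [← hdiag, hA', hB']; noncomm_ring
  set D' := U.conjTranspose * (A * A - B * B) * U with hD'
  have hDAB : D' = A' * A' - B' * B' := by
    rw [hD', hA', hB', unitary_conj_mul hU, unitary_conj_mul hU]; noncomm_ring
  have hfro : (D'.conjTranspose * D').trace
      = ((A * A - B * B).conjTranspose * (A * A - B * B)).trace := by
    rw [hD', conjTranspose_unitary_conj, unitary_conj_mul hU, trace_unitary_conj hU]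
  have htr : ((A - B) * (A - B)).trace.re = ∑ i, c i ^ 2 := by
    rw [← trace_unitary_conj hU, ← unitary_conj_mul hU, hdiag, Matrix.diagonal_mul_diagonal,
      Matrix.trace_diagonal, Complex.re_sum]
    refine Finset.sum_congr rfl fun i _ => ?_
    rw [← Complex.ofReal_mul, Complex.ofReal_re]; ring
  rw [htr, ← hfro]
  refine le_trans (Finset.sum_le_sum fun i _ => ?_) (sum_norm_diag_le D')
  -- In the eigenbasis of `A - B` the real part of this entry is c(a + b), with a, b ≥ 0 the
  -- diagonal entries of `A'`, `B'` and c = a - b. Since |c| ≤ a + b, it dominates c² in absolute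
  -- value.
  have hent : D' i i = 2 * B' i i * c i + c i ^ 2 := by
    rw [hDAB, hAB]
    simp only [add_mul, mul_add, Matrix.sub_apply, Matrix.add_apply, Matrix.diagonal_mul_diagonal,
      Matrix.diagonal_apply_eq, Matrix.mul_diagonal, Matrix.diagonal_mul]
    ring
  have hre : (D' i i).re = c i * (2 * (B' i i).re + c i) := by
    rw [hent]
    simp [pow_two]
    ring
  have hai : (A' i i).re = (B' i i).re + c i := by
    rw [hAB]; simp
  have h1 := hAd i
  have h2 := hBd i
  have h3 := Complex.abs_re_le_norm (D' i i)
  refine le_trans ?_ h3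
  rw [hre, abs_mul]
  have : |c i| ≤ |2 * (B' i i).re + c i| := by
    rw [hai] at h1
    rw [abs_of_nonneg (by linarith : 0 ≤ 2 * (B' i i).re + c i), abs_le]
    constructor <;> linarith
  calc c i ^ 2 = |c i| * |c i| := by rw [abs_mul_abs_self]; ring
    _ ≤ _ := mul_le_mul_of_nonneg_left this (abs_nonneg _)

lemma trace_abs_le (D : Matrix (Fin d) (Fin d) ℂ) :
    (CFC.abs D).trace.re ≤ Real.sqrt d * Real.sqrt (D.conjTranspose * D).trace.re := by
  have hp : (CFC.abs D).PosSemidef := Matrix.nonneg_iff_posSemidef.1 (CFC.abs_nonneg D)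
  have hsq : (CFC.abs D).conjTranspose * CFC.abs D = D.conjTranspose * D := by
    rw [hp.1.eq]; exact CFC.abs_mul_abs D
  rw [← hsq]
  refine le_trans ?_ (sum_norm_diag_le _)
  rw [Matrix.trace, Complex.re_sum]
  exact Finset.sum_le_sum fun i _ => Complex.re_le_norm _

/-- The root fidelity Tr|√ρ√ρ'| is at least Re Tr √ρ√ρ' = 1 - ½ Tr(√ρ' - √ρ)², and `trace_sub_sq_le`
bounds the last trace. -/
lemma infidelity_le {ρ' ρ : Matrix (Fin d) (Fin d) ℂ} (hρ' : IsDensityMatrix ρ')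
    (hρ : IsDensityMatrix ρ) :
    1 - (CFC.sqrt (CFC.sqrt ρ' * ρ * CFC.sqrt ρ')).trace.re ^ 2 ≤
      Real.sqrt d * Real.sqrt ((ρ' - ρ).conjTranspose * (ρ' - ρ)).trace.re := by
  have hs : CFC.sqrt ρ * CFC.sqrt ρ = ρ :=
    CFC.sqrt_mul_sqrt_self ρ (Matrix.nonneg_iff_posSemidef.2 hρ.1)
  have hs' : CFC.sqrt ρ' * CFC.sqrt ρ' = ρ' :=
    CFC.sqrt_mul_sqrt_self ρ' (Matrix.nonneg_iff_posSemidef.2 hρ'.1)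
  have hp : (CFC.sqrt ρ).PosSemidef := Matrix.nonneg_iff_posSemidef.1 (CFC.sqrt_nonneg ρ)
  have hp' : (CFC.sqrt ρ').PosSemidef := Matrix.nonneg_iff_posSemidef.1 (CFC.sqrt_nonneg ρ')
  set S := CFC.sqrt ρ
  set S' := CFC.sqrt ρ'
  set F := CFC.sqrt (S' * ρ * S') with hF
  have hX : S' * ρ * S' = (S * S').conjTranspose * (S * S') := by
    rw [Matrix.conjTranspose_mul, hp.1.eq, hp'.1.eq, ← hs]; simp only [mul_assoc]
  have hFp : F.PosSemidef := Matrix.nonneg_iff_posSemidef.1 (CFC.sqrt_nonneg _)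
  have hFF : F * F = (S * S').conjTranspose * (S * S') := by
    rw [← hX]
    refine CFC.sqrt_mul_sqrt_self _ (Matrix.nonneg_iff_posSemidef.2 ?_)
    rw [hX]; exact Matrix.posSemidef_conjTranspose_mul_self _
  have h1 := re_trace_le_of_sq_eq hFp hFF
  have h2 := trace_sub_sq_le hp' hp
  rw [hs, hs'] at h2
  have h3 : ((S' - S) * (S' - S)).trace.re = 2 - 2 * (S * S').trace.re := by
    have : (S' - S) * (S' - S) = ρ' + ρ - S * S' - S' * S := by
      rw [← hs, ← hs']; noncomm_ring
    rw [this, Matrix.trace_sub, Matrix.trace_sub, Matrix.trace_add, hρ.2, hρ'.2,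
      Matrix.trace_mul_comm S' S]
    simp only [Complex.sub_re, Complex.add_re, Complex.one_re]; ring
  -- The square supplies 1 - x² ≤ 2 - 2x for x = Tr F.
  nlinarith [sq_nonneg (F.trace.re - 1)]

/-- The constant `K` in `Δ ≤ K ‖s' - s‖` for the Bloch vectors `s'`, `s`. -/
noncomputable def lossConst (d : ℕ) : Loss → ℝ
  | .hilbertSchmidt => 1 / 2
  | .traceDistance => Real.sqrt (d / 8)
  | .infidelity => Real.sqrt (d / 2)

lemma Loss.val_le (L : Loss) {ρ' ρ : Matrix (Fin d) (Fin d) ℂ} (hρ' : IsDensityMatrix ρ')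
    (hρ : IsDensityMatrix ρ) :
    L.val ρ' ρ ≤
      lossConst d L * Real.sqrt (2 * ((ρ' - ρ).conjTranspose * (ρ' - ρ)).trace.re) := by
  have hherm : (ρ' - ρ).conjTranspose = ρ' - ρ := (hρ'.1.1.sub hρ.1.1).eq
  have h2 : (0:ℝ) < Real.sqrt 2 := by positivity
  have h22 : Real.sqrt 2 * Real.sqrt 2 = 2 := Real.mul_self_sqrt (by norm_num)
  cases L with
  | hilbertSchmidt =>
    simp only [Loss.val, lossConst]
    rw [hherm, pow_two, Real.sqrt_mul (by norm_num), ← mul_assoc]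
    refine le_of_eq (congrArg (· * _) ?_)
    field_simp
    linarith
  | traceDistance =>
    simp only [Loss.val, lossConst]
    have h := trace_abs_le (ρ' - ρ)
    rw [← Real.sqrt_mul (by positivity)]
    rw [← Real.sqrt_mul (by positivity)] at h
    have h4 : (d / 8 * (2 * ((ρ' - ρ).conjTranspose * (ρ' - ρ)).trace.re) : ℝ)
      = (1 / 2) ^ 2 * (d * ((ρ' - ρ).conjTranspose * (ρ' - ρ)).trace.re) := by ring
    rw [h4, Real.sqrt_mul (by positivity), Real.sqrt_sq (by norm_num)]
    exact mul_le_mul_of_nonneg_left h (by norm_num)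
  | infidelity =>
    simp only [Loss.val, lossConst]
    refine (infidelity_le hρ' hρ).trans (le_of_eq ?_)
    rw [← Real.sqrt_mul (by positivity), ← Real.sqrt_mul (by positivity)]
    congr 1; ring

end MatrixInequalities

/-! ### Bloch coordinates and injectivity of the measurement map -/

section Bloch

variable {d : ℕ} {l : Fin (d ^ 2 - 1) → Matrix (Fin d) (Fin d) ℂ}

/-- The Bloch coordinates `Tr (D l_α)` of a Hermitian matrix. -/
noncomputable def bloch (l : Fin (d ^ 2 - 1) → Matrix (Fin d) (Fin d) ℂ)
    (D : Matrix (Fin d) (Fin d) ℂ) : EuclideanSpace ℝ (Fin (d ^ 2 - 1)) :=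
  WithLp.toLp 2 fun α => (D * l α).trace.re

lemma trace_mul_im_eq_zero {X Y : Matrix (Fin d) (Fin d) ℂ} (hX : X.IsHermitian)
    (hY : Y.IsHermitian) : (X * Y).trace.im = 0 := by
  apply Complex.conj_eq_iff_im.1
  rw [← Complex.star_def, ← Matrix.trace_conjTranspose, Matrix.conjTranspose_mul, hX.eq, hY.eq,
    Matrix.trace_mul_comm]

/-- Completeness by dimension count: the functionals in question map onto a space of dimension 1 +
(d² - 1) = d², so they are jointly injective. The case d = 0 is separate because d² - 1 truncates
there. -/
lemma IsBlochBasis.eq_zero (hl : IsBlochBasis l) {D : Matrix (Fin d) (Fin d) ℂ}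
    (h0 : D.trace = 0) (hD : ∀ α, (D * l α).trace = 0) : D = 0 := by
  rcases Nat.eq_zero_or_pos d with rfl | hd
  · ext i; exact i.elim0
  let Φ : Matrix (Fin d) (Fin d) ℂ →ₗ[ℂ] ℂ × (Fin (d ^ 2 - 1) → ℂ) :=
    (Matrix.traceLinearMap (Fin d) ℂ ℂ).prod
      (LinearMap.pi fun α => (Matrix.traceLinearMap (Fin d) ℂ ℂ).comp (LinearMap.mulRight ℂ (l α)))
  have hdim : Module.finrank ℂ (Matrix (Fin d) (Fin d) ℂ) =
      Module.finrank ℂ (ℂ × (Fin (d ^ 2 - 1) → ℂ)) := by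
    have : 0 < d ^ 2 := by positivity
    simp [Module.finrank_matrix, Module.finrank_prod]
    rw [← pow_two]; omega
  have hsurj : Function.Surjective Φ := by
    rintro ⟨a, c⟩
    have hd0 : (d : ℂ) ≠ 0 := by exact_mod_cast hd.ne'
    refine ⟨(a / d) • 1 + ∑ β, (c β / 2) • l β, Prod.ext ?_ (funext fun α => ?_)⟩
    · simp [Φ, Matrix.trace_sum, hl.2.1, hd0]
    · simp [Φ, Matrix.trace_sum, hl.2.1, hl.2.2]
  have hinj := (LinearMap.injective_iff_surjective_of_finrank_eq_finrank hdim).2 hsurj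
  apply hinj
  rw [map_zero]
  exact Prod.ext h0 (funext hD)

lemma IsBlochBasis.expansion (hl : IsBlochBasis l) {D : Matrix (Fin d) (Fin d) ℂ}
    (hD : D.IsHermitian) (h0 : D.trace = 0) :
    D = ∑ α, ((bloch l D α / 2 : ℝ) : ℂ) • l α := by
  rw [← sub_eq_zero]
  apply hl.eq_zero
  · simp [Matrix.trace_sum, h0, hl.2.1]
  · intro α
    have h1 : (D * l α).trace = ((bloch l D α : ℝ) : ℂ) :=
      Complex.ext (by simp [bloch]) (by simpa using trace_mul_im_eq_zero hD (hl.1 α))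
    simp [sub_mul, Finset.sum_mul, Matrix.trace_sum, hl.2.2, h1]

lemma trace_mul_blochSum (v : Fin (d ^ 2 - 1) → ℝ) (Y : Matrix (Fin d) (Fin d) ℂ) :
    (Y * ∑ α, ((v α / 2 : ℝ) : ℂ) • l α).trace.re = ∑ α, (Y * l α).trace.re / 2 * v α := by
  rw [Finset.mul_sum, Matrix.trace_sum, Complex.re_sum]
  refine Finset.sum_congr rfl fun α _ => ?_
  rw [Matrix.mul_smul, Matrix.trace_smul, smul_eq_mul, Complex.re_ofReal_mul]
  ring

lemma IsBlochBasis.trace_blochSum_mul (hl : IsBlochBasis l) (v : Fin (d ^ 2 - 1) → ℝ)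
    (β : Fin (d ^ 2 - 1)) :
    ((∑ α, ((v α / 2 : ℝ) : ℂ) • l α) * l β).trace.re = v β := by
  rw [Matrix.trace_mul_comm, trace_mul_blochSum]
  simp [hl.2.2, apply_ite Complex.re, ite_div, ite_mul]

lemma isHermitian_blochSum (hl : IsBlochBasis l) (v : Fin (d ^ 2 - 1) → ℝ) :
    (∑ α, ((v α / 2 : ℝ) : ℂ) • l α).IsHermitian := by
  unfold Matrix.IsHermitian
  rw [Matrix.conjTranspose_sum]
  refine Finset.sum_congr rfl fun α _ => ?_
  rw [Matrix.conjTranspose_smul, (hl.1 α).eq, Complex.star_def, Complex.conj_ofReal]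

lemma IsBlochBasis.norm_bloch (hl : IsBlochBasis l) {D : Matrix (Fin d) (Fin d) ℂ}
    (hD : D.IsHermitian) (h0 : D.trace = 0) :
    Real.sqrt (2 * (D.conjTranspose * D).trace.re) = ‖bloch l D‖ := by
  rw [hD.eq, EuclideanSpace.norm_eq]
  congr 1
  have h := trace_mul_blochSum (l := l) (bloch l D) D
  rw [← hl.expansion hD h0] at h
  rw [h, Finset.mul_sum]
  refine Finset.sum_congr rfl fun α _ => ?_
  rw [Real.norm_eq_abs, sq_abs]
  change 2 * (bloch l D α / 2 * bloch l D α) = _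
  ring

variable {J : ℕ} {M : Fin J → ℕ} {E : (j : Fin J) → Fin (M j) → Matrix (Fin d) (Fin d) ℂ}

lemma probVec_sub (σ τ : Matrix (Fin d) (Fin d) ℂ) :
    probVec E σ - probVec E τ = WithLp.toLp 2 fun i => born (E i.1 i.2) (σ - τ) := by
  ext i
  simp [probVec, born, mul_sub]

lemma IsBlochBasis.probVec_sub_eq (hl : IsBlochBasis l) {σ τ : Matrix (Fin d) (Fin d) ℂ}
    (hσ : IsDensityMatrix σ) (hτ : IsDensityMatrix τ) :
    probVec E σ - probVec E τ =
      WithLp.toLp 2 ((designMatrix E l).mulVec (bloch l (σ - τ)).ofLp) := by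
  rw [probVec_sub]
  congr 1
  ext i
  have hD : (σ - τ).IsHermitian := hσ.1.1.sub hτ.1.1
  have h0 : (σ - τ).trace = 0 := by rw [Matrix.trace_sub, hσ.2, hτ.2, sub_self]
  rw [born]
  conv_lhs => rw [hl.expansion hD h0]
  rw [trace_mul_blochSum]
  rfl

/-- Orthogonality to the POVM elements passes to their span, which contains `X` itself, so Tr X² =
0. -/
lemma IsInformationallyComplete.eq_zero (hIC : IsInformationallyComplete E)
    {X : Matrix (Fin d) (Fin d) ℂ} (hX : X.IsHermitian) (h : ∀ j m, born (E j m) X = 0) :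
    X = 0 := by
  have key : ∀ Y ∈ Submodule.span ℝ {X | ∃ j, ∃ m, X = E j m}, born Y X = 0 := by
    intro Y hY
    induction hY using Submodule.span_induction with
    | mem Y hY => obtain ⟨j, m, rfl⟩ := hY; exact h j m
    | zero => simp [born]
    | add Y Z _ _ hY hZ => simp only [born, add_mul, Matrix.trace_add, Complex.add_re] at *; linarith
    | smul a Y _ hY => simp only [born, Matrix.smul_mul, Matrix.trace_smul, Complex.smul_re] at *
                       simp [hY]
  rw [hIC] at key
  have h1 : (X.conjTranspose * X).trace.re = 0 := by
    rw [hX.eq]; exact key X hX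
  have h2 : (X.conjTranspose * X).trace = 0 :=
    Complex.ext h1 (by rw [hX.eq]; exact trace_mul_im_eq_zero hX hX)
  exact Matrix.trace_conjTranspose_mul_self_eq_zero_iff.1 h2

lemma designMatrix_mulVec_injective (hIC : IsInformationallyComplete E) (hl : IsBlochBasis l) :
    Function.Injective (designMatrix E l).mulVec := by
  suffices h : ∀ v, (designMatrix E l).mulVec v = 0 → v = 0 by
    intro v w hvw
    rw [← sub_eq_zero]
    apply h
    rw [Matrix.mulVec_sub, sub_eq_zero]
    exact hvw
  intro v hv
  have h0 := hIC.eq_zero (isHermitian_blochSum hl v) fun j m => by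
    rw [born, trace_mul_blochSum]
    exact congrFun hv ⟨j, m⟩
  ext β
  rw [← hl.trace_blochSum_mul v β, h0]
  simp

end Bloch

/-! ### Least squares and the extremal stretches of A -/

section LeftInverse

variable {ι κ : Type*} [Fintype ι] [Fintype κ] {A : Matrix ι κ ℝ}

/-- The least-squares solution satisfies the normal equations. -/
lemma transpose_mulVec_leftInv [DecidableEq κ] (hA : Function.Injective A.mulVec) (g : ι → ℝ) :
    A.transpose.mulVec (A.mulVec ((leftInv A).mulVec g)) = A.transpose.mulVec g := by
  have hpd := Matrix.PosDef.conjTranspose_mul_self A hA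
  rw [Matrix.conjTranspose_eq_transpose_of_trivial] at hpd
  have hu := (Matrix.isUnit_iff_isUnit_det _).1 hpd.isUnit
  simp only [leftInv, Matrix.mulVec_mulVec]
  rw [← Matrix.mul_assoc, ← Matrix.mul_assoc, Matrix.mul_nonsing_inv _ hu, Matrix.one_mul]

/-- The normal equations say that the residual of `g` is orthogonal to the range of `A`. -/
lemma inner_mulVec_leftInv [DecidableEq κ] (hA : Function.Injective A.mulVec)
    (g : EuclideanSpace ℝ ι) (y : κ → ℝ) :
    inner ℝ (WithLp.toLp 2 (A.mulVec ((leftInv A).mulVec g.ofLp)) : EuclideanSpace ℝ ι)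
        (WithLp.toLp 2 (A.mulVec y)) =
      inner ℝ g (WithLp.toLp 2 (A.mulVec y)) := by
  have h := congrArg (fun w => y ⬝ᵥ w) (transpose_mulVec_leftInv hA g.ofLp)
  simp only [Matrix.mulVec_transpose, ← Matrix.dotProduct_mulVec, dotProduct_comm y] at h
  simpa [EuclideanSpace.inner_eq_star_dotProduct, dotProduct_comm] using h

lemma stretch_nonneg (v : EuclideanSpace ℝ κ) : 0 ≤ stretch A v := by
  unfold stretch; positivity

lemma stretch_bddAbove : BddAbove {t | ∃ v : EuclideanSpace ℝ κ, v ≠ 0 ∧ t = stretch A v} := by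
  classical
  let T : EuclideanSpace ℝ κ →L[ℝ] EuclideanSpace ℝ ι :=
    LinearMap.toContinuousLinearMap (Matrix.toLpLin 2 2 A)
  refine ⟨‖T‖, ?_⟩
  rintro t ⟨v, hv, rfl⟩
  rw [stretch, div_le_iff₀ (norm_pos_iff.2 hv)]
  exact T.le_opNorm v

lemma stretch_bddBelow : BddBelow {t | ∃ v : EuclideanSpace ℝ κ, v ≠ 0 ∧ t = stretch A v} :=
  ⟨0, by rintro t ⟨v, -, rfl⟩; exact stretch_nonneg v⟩

lemma norm_mulVec_le_normMax (v : EuclideanSpace ℝ κ) :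
    ‖(WithLp.toLp 2 (A.mulVec v.ofLp) : EuclideanSpace ℝ ι)‖ ≤ normMax A * ‖v‖ := by
  by_cases hv : v = 0
  · simp [hv]
  rw [← div_le_iff₀ (norm_pos_iff.2 hv)]
  exact le_csSup stretch_bddAbove ⟨v, hv, rfl⟩

lemma normMin_mul_le_norm_mulVec (v : EuclideanSpace ℝ κ) :
    normMin A * ‖v‖ ≤ ‖(WithLp.toLp 2 (A.mulVec v.ofLp) : EuclideanSpace ℝ ι)‖ := by
  by_cases hv : v = 0
  · simp [hv]
  rw [← le_div_iff₀ (norm_pos_iff.2 hv)]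
  exact csInf_le stretch_bddBelow ⟨v, hv, rfl⟩

lemma normMin_nonneg : 0 ≤ normMin A :=
  Real.sInf_nonneg (by rintro t ⟨v, -, rfl⟩; exact stretch_nonneg v)

lemma normMax_nonneg : 0 ≤ normMax A :=
  Real.sSup_nonneg (by rintro t ⟨v, -, rfl⟩; exact stretch_nonneg v)

lemma normMin_le_normMax : normMin A ≤ normMax A := by
  by_cases h : ∃ v : EuclideanSpace ℝ κ, v ≠ 0
  · obtain ⟨v, hv⟩ := h
    exact (csInf_le stretch_bddBelow ⟨v, hv, rfl⟩).trans (le_csSup stretch_bddAbove ⟨v, hv, rfl⟩)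
  · push Not at h
    -- Without nonzero vectors (as for d = 1) both extrema range over the empty set and equal 0 by
    -- convention.
    simp [normMin, normMax, h]

lemma ratio_mul_norm_le {y z : EuclideanSpace ℝ κ}
    (h : ‖(WithLp.toLp 2 (A.mulVec y.ofLp) : EuclideanSpace ℝ ι)‖ ≤
      ‖(WithLp.toLp 2 (A.mulVec z.ofLp) : EuclideanSpace ℝ ι)‖) :
    normMin A / normMax A * ‖y‖ ≤ ‖z‖ := by
  have h1 := (normMin_mul_le_norm_mulVec (A := A) y).trans (h.trans (norm_mulVec_le_normMax z))
  rcases (normMax_nonneg (A := A)).eq_or_lt with h0 | h0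
  · rw [← h0]; simp
  · rw [div_mul_eq_mul_div, div_le_iff₀ h0]; linarith

end LeftInverse

/-! ### The constrained estimate as a convex projection -/

section Estimator

variable {d J : ℕ} {M : Fin J → ℕ} {E : (j : Fin J) → Fin (M j) → Matrix (Fin d) (Fin d) ℂ}

lemma convex_densityMatrix : Convex ℝ {σ : Matrix (Fin d) (Fin d) ℂ | IsDensityMatrix σ} := by
  rintro σ ⟨hσ, hσ1⟩ τ ⟨hτ, hτ1⟩ a b ha hb hab
  refine ⟨(hσ.smul ha).add (hτ.smul hb), ?_⟩
  rw [Matrix.trace_add, Matrix.trace_smul, Matrix.trace_smul, hσ1, hτ1, ← add_smul, hab, one_smul]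

/-- The set is the continuous image of the Frobenius unit sphere under B ↦ B*B. -/
lemma isCompact_densityMatrix :
    IsCompact {σ : Matrix (Fin d) (Fin d) ℂ | IsDensityMatrix σ} := by
  have hS : IsCompact {B : Fin d → Fin d → ℂ |
      ((Matrix.of B).conjTranspose * Matrix.of B).trace = 1} := by
    refine Metric.isCompact_of_isClosed_isBounded ?_ ?_
    · refine isClosed_eq ?_ continuous_const
      exact Continuous.matrix_trace (Continuous.mul (Continuous.matrix_conjTranspose continuous_id)
        continuous_id)
    · refine (Metric.isBounded_closedBall (x := 0) (r := 1)).subset fun B hB => ?_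
      rw [mem_closedBall_zero_iff, pi_norm_le_iff_of_nonneg zero_le_one]
      intro i
      rw [pi_norm_le_iff_of_nonneg zero_le_one]
      intro j
      have h := congrArg Complex.re hB
      rw [trace_conjTranspose_mul_self_re, Complex.one_re] at h
      have h1 : ‖B i j‖ ^ 2 ≤ 1 := by
        rw [← h]
        refine le_trans ?_ (Finset.single_le_sum
          (f := fun j => ∑ i, ‖Matrix.of B i j‖ ^ 2)
          (fun j _ => Finset.sum_nonneg fun i _ => sq_nonneg _) (Finset.mem_univ j))
        exact Finset.single_le_sum (f := fun i => ‖Matrix.of B i j‖ ^ 2)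
          (fun i _ => sq_nonneg _) (Finset.mem_univ i)
      nlinarith [norm_nonneg (B i j)]
  have hc : Continuous fun B : Fin d → Fin d → ℂ => (Matrix.of B).conjTranspose * Matrix.of B :=
    Continuous.mul (Continuous.matrix_conjTranspose continuous_id) continuous_id
  convert hS.image hc
  ext σ
  constructor
  · rintro ⟨hσ, h1⟩
    obtain ⟨B, rfl⟩ := CStarAlgebra.nonneg_iff_eq_star_mul_self.1
      (Matrix.nonneg_iff_posSemidef.2 hσ)
    exact ⟨B, h1, rfl⟩
  · rintro ⟨B, hB, rfl⟩
    exact ⟨Matrix.posSemidef_conjTranspose_mul_self _, hB⟩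

lemma continuous_probVec : Continuous (probVec E) := by
  refine (PiLp.continuous_toLp 2 _).comp (continuous_pi fun i => ?_)
  exact Complex.continuous_re.comp (Continuous.matrix_trace (continuous_const.mul continuous_id))

lemma convex_image_probVec : Convex ℝ (probVec E '' {σ | IsDensityMatrix σ}) := by
  rintro _ ⟨σ, hσ, rfl⟩ _ ⟨τ, hτ, rfl⟩ a b ha hb hab
  refine ⟨a • σ + b • τ, convex_densityMatrix hσ hτ ha hb hab, ?_⟩
  ext i
  simp [probVec, born, mul_add, Matrix.trace_smul]

lemma probVec_injOn (hIC : IsInformationallyComplete E) :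
    Set.InjOn (probVec E) {σ | IsDensityMatrix σ} := by
  intro σ hσ τ hτ h
  rw [← sub_eq_zero] at h ⊢
  rw [probVec_sub] at h
  exact hIC.eq_zero (hσ.1.1.sub hτ.1.1) fun j m =>
    congrFun (congrArg WithLp.ofLp h) (⟨j, m⟩ : Outcome M)

lemma IsCLSEstimate.inner_le_zero {f : EuclideanSpace ℝ (Outcome M)}
    {ρ' σ : Matrix (Fin d) (Fin d) ℂ} (h : IsCLSEstimate E f ρ') (hσ : IsDensityMatrix σ) :
    inner ℝ (f - probVec E ρ') (probVec E σ - probVec E ρ') ≤ 0 := by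
  refine (norm_eq_iInf_iff_real_inner_le_zero (convex_image_probVec (E := E))
    (Set.mem_image_of_mem _ h.1)).1 ?_ _ (Set.mem_image_of_mem _ hσ)
  have : Nonempty (probVec E '' {σ | IsDensityMatrix σ}) := ⟨⟨_, Set.mem_image_of_mem _ h.1⟩⟩
  refine le_antisymm (le_ciInf ?_) ?_
  · rintro ⟨_, τ, hτ, rfl⟩
    simpa only [norm_sub_rev f] using h.2 τ hτ
  · exact ciInf_le (f := fun w : probVec E '' {σ | IsDensityMatrix σ} => ‖f - w‖)
      ⟨0, by rintro _ ⟨w, rfl⟩; exact norm_nonneg _⟩ ⟨_, Set.mem_image_of_mem _ h.1⟩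

lemma existsUnique_isCLSEstimate (hIC : IsInformationallyComplete E)
    {ρ : Matrix (Fin d) (Fin d) ℂ} (hρ : IsDensityMatrix ρ) (f : EuclideanSpace ℝ (Outcome M)) :
    ∃! ρ', IsCLSEstimate E f ρ' := by
  obtain ⟨ρ', hρ', hmin⟩ := isCompact_densityMatrix.exists_isMinOn ⟨ρ, hρ⟩
    (f := fun σ => ‖probVec E σ - f‖)
    (continuous_probVec.sub continuous_const).norm.continuousOn
  refine ⟨ρ', ⟨hρ', fun σ hσ => hmin hσ⟩, fun τ hτ => ?_⟩
  have hρ'' : IsCLSEstimate E f ρ' := ⟨hρ', fun σ hσ => hmin hσ⟩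
  refine probVec_injOn hIC hτ.1 hρ' ?_
  have h1 := hτ.inner_le_zero hρ'
  have h2 := hρ''.inner_le_zero hτ.1
  rw [← sub_eq_zero]
  refine real_inner_self_nonpos.1 ?_
  -- The two obtuse-angle inequalities, each minimiser tested against the other, add up to the
  -- squared distance.
  have h3 : inner ℝ (probVec E τ - probVec E ρ') (probVec E τ - probVec E ρ') =
      inner ℝ (f - probVec E τ) (probVec E ρ' - probVec E τ) +
      inner ℝ (f - probVec E ρ') (probVec E τ - probVec E ρ') := by
    rw [← neg_sub (probVec E τ) (probVec E ρ'), inner_neg_right, ← sub_eq_neg_add,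
      ← inner_sub_left]
    congr 1; abel
  rw [h3]
  simpa using add_nonpos h1 h2

variable {l : Fin (d ^ 2 - 1) → Matrix (Fin d) (Fin d) ℂ}

/-- The error of the constrained estimate is controlled by that of the linear estimate. -/
lemma IsCLSEstimate.ratio_mul_norm_le (hIC : IsInformationallyComplete E) (hl : IsBlochBasis l)
    {ρ ρ' : Matrix (Fin d) (Fin d) ℂ} (hρ : IsDensityMatrix ρ)
    {f : EuclideanSpace ℝ (Outcome M)} (h : IsCLSEstimate E f ρ') :
    normMin (designMatrix E l) / normMax (designMatrix E l) * ‖bloch l (ρ' - ρ)‖ ≤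
      ‖(WithLp.toLp 2 ((leftInv (designMatrix E l)).mulVec (f - probVec E ρ).ofLp) :
        EuclideanSpace ℝ (Fin (d ^ 2 - 1)))‖ := by
  apply QTomo.ratio_mul_norm_le
  set y := bloch l (ρ' - ρ)
  set A := designMatrix E l
  have hy : probVec E ρ' - probVec E ρ = WithLp.toLp 2 (A.mulVec y.ofLp) := hl.probVec_sub_eq h.1 hρ
  have h1 := h.inner_le_zero hρ
  have h2 := inner_mulVec_leftInv (designMatrix_mulVec_injective hIC hl) (f - probVec E ρ) y.ofLp
  rw [← hy] at h2 ⊢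
  set p := probVec E ρ' - probVec E ρ
  set w : EuclideanSpace ℝ (Outcome M) :=
    WithLp.toLp 2 (A.mulVec ((leftInv A).mulVec (f - probVec E ρ).ofLp))
  -- Because `p` lies in the range of `A`, the data error may be replaced by its projection `w`.
  have h3 : inner ℝ p p ≤ inner ℝ w p := by
    have e1 : probVec E ρ - probVec E ρ' = -p := by simp [p]
    have e2 : f - probVec E ρ' = (f - probVec E ρ) - p := by simp [p]
    rw [e1, e2, inner_neg_right, inner_sub_left, ← h2] at h1
    linarith
  have h4 := h3.trans (real_inner_le_norm w p)
  rw [real_inner_self_eq_norm_mul_norm] at h4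
  rcases (norm_nonneg p).eq_or_lt with h0 | h0
  · rw [← h0]; exact norm_nonneg _
  · exact le_of_mul_le_mul_right h4 h0

end Estimator

/-! ### Concentration of the relative frequencies -/

section Hoeffding

variable {Ω : Type*} [MeasurableSpace Ω] {P : Measure Ω} [IsProbabilityMeasure P]

/-- Two-sided Hoeffding inequality for independent bounded random variables. -/
lemma measureReal_abs_sum_ge_le {ι : Type*} [Fintype ι] {Y : ι → Ω → ℝ} (hY : iIndepFun Y P)
    (hm : ∀ i, Measurable (Y i)) {a b : ι → ℝ} (hab : ∀ i ω, Y i ω ∈ Set.Icc (a i) (b i))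
    {t : ℝ} (ht : 0 ≤ t) :
    P.real {ω | t ≤ |∑ i, (Y i ω - P[Y i])|} ≤
      2 * Real.exp (-(2 * t ^ 2 / ∑ i, (b i - a i) ^ 2)) := by
  have hsub : ∀ i, HasSubgaussianMGF (fun ω => Y i ω - P[Y i]) ((‖b i - a i‖₊ / 2) ^ 2) P :=
    fun i => hasSubgaussianMGF_of_mem_Icc (hm i).aemeasurable (ae_of_all _ (hab i))
  have hind : iIndepFun (fun i ω => Y i ω - P[Y i]) P :=
    hY.comp (fun i x => x - ∫ ω, Y i ω ∂P) fun i => measurable_id.sub_const _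
  have hind' : iIndepFun (fun i ω => -(Y i ω - P[Y i])) P :=
    hY.comp (fun i x => -(x - ∫ ω, Y i ω ∂P)) fun i => (measurable_id.sub_const _).neg
  have h1 := HasSubgaussianMGF.measure_sum_ge_le_of_iIndepFun hind (s := Finset.univ)
    (fun i _ => hsub i) ht
  have h2 := HasSubgaussianMGF.measure_sum_ge_le_of_iIndepFun hind' (s := Finset.univ)
    (fun i _ => (hsub i).neg) ht
  have hexp : -t ^ 2 / (2 * (∑ i, (‖b i - a i‖₊ / 2) ^ 2 : NNReal)) =
      -(2 * t ^ 2 / ∑ i, (b i - a i) ^ 2) := by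
    push_cast
    simp only [Real.norm_eq_abs, div_pow, sq_abs]
    rw [← Finset.sum_div]
    set S := ∑ i, (b i - a i) ^ 2
    rcases eq_or_ne S 0 with hS | hS
    · simp [hS]
    · field_simp
  push_cast at h1 h2 hexp
  rw [hexp] at h1 h2
  calc P.real {ω | t ≤ |∑ i, (Y i ω - P[Y i])|}
      ≤ P.real ({ω | t ≤ ∑ i, (Y i ω - P[Y i])} ∪ {ω | t ≤ ∑ i, -(Y i ω - P[Y i])}) := by
        refine measureReal_mono fun ω hω => ?_
        simpa only [Set.mem_union, Set.mem_ofPred_eq, Finset.sum_neg_distrib] using le_abs.1 hω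
    _ ≤ _ := (measureReal_union_le _ _).trans (by linarith)

variable {J : ℕ} {M n : Fin J → ℕ}

lemma integral_comp_outcome {k : ℕ} {X : Ω → Fin k} (hX : Measurable X) (g : Fin k → ℝ) :
    P[fun ω => g (X ω)] = ∑ m, P.real {ω | X ω = m} * g m := by
  have := Measure.isProbabilityMeasure_map (μ := P) hX.aemeasurable
  rw [← integral_map (φ := X) (f := g) hX.aemeasurable
    (measurable_of_finite g).aestronglyMeasurable, integral_fintype .of_finite]
  refine Finset.sum_congr rfl fun m _ => ?_
  rw [smul_eq_mul, map_measureReal_apply hX (measurableSet_singleton m)]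
  rfl

/-- Frequencies of different outcomes of one POVM are dependent; regrouping by trial exposes
independent summands. -/
lemma sum_mul_freqVec (g : Outcome M → ℝ) (x : (j : Fin J) → Fin (n j) → Fin (M j)) :
    ∑ i, g i * freqVec x i = ∑ i : (Σ j, Fin (n j)), g ⟨i.1, x i.1 i.2⟩ / n i.1 := by
  rw [Fintype.sum_sigma, Fintype.sum_sigma]
  refine Finset.sum_congr rfl fun j _ => ?_
  simp only [freqVec, Finset.card_filter, Nat.cast_sum, Finset.sum_div, Finset.mul_sum]
  change ∑ m : Fin (M j), ∑ q : Fin (n j),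
    g ⟨j, m⟩ * (((if x j q = m then 1 else 0 : ℕ) : ℝ) / n j) = ∑ q, g ⟨j, x j q⟩ / (n j : ℝ)
  rw [Finset.sum_comm]
  refine Finset.sum_congr rfl fun q _ => ?_
  simp [div_eq_mul_inv]

/-- Concentration of a linear functional of the relative frequencies. -/
lemma measureReal_abs_freq_ge_le (hn : ∀ j, 0 < n j) {p : Outcome M → ℝ}
    {X : (j : Fin J) → Fin (n j) → Ω → Fin (M j)} (hXm : ∀ j q, Measurable (X j q))
    (hXi : iIndepFun (fun (i : Σ j : Fin J, Fin (n j)) => X i.1 i.2) P)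
    (hXlaw : ∀ j q m, P.real {ω | X j q ω = m} = p ⟨j, m⟩) (g : Outcome M → ℝ)
    {t : ℝ} (ht : 0 ≤ t) :
    P.real {ω | t ≤ |∑ i, g i * (freqVec (fun j q => X j q ω) i - p i)|} ≤
      2 * Real.exp (-(2 * t ^ 2 /
        ∑ j, ((⨆ m, g ⟨j, m⟩) - ⨅ m, g ⟨j, m⟩) ^ 2 / n j)) := by
  have hY : iIndepFun (fun (i : Σ j, Fin (n j)) ω => g ⟨i.1, X i.1 i.2 ω⟩ / n i.1) P :=
    hXi.comp (fun i m => g ⟨i.1, m⟩ / n i.1) fun i => measurable_of_finite _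
  have h := measureReal_abs_sum_ge_le hY
    (fun i => (measurable_of_finite fun m => g ⟨i.1, m⟩ / (n i.1 : ℝ)).comp (hXm i.1 i.2))
    (a := fun i => (⨅ m, g ⟨i.1, m⟩) / n i.1) (b := fun i => (⨆ m, g ⟨i.1, m⟩) / n i.1)
    (fun i ω => ⟨div_le_div_of_nonneg_right (ciInf_le (Set.finite_range _).bddBelow _)
        (Nat.cast_nonneg _),
      div_le_div_of_nonneg_right (le_ciSup (f := fun m => g ⟨i.1, m⟩)
        (Set.finite_range _).bddAbove _) (Nat.cast_nonneg _)⟩) ht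
  have hint : ∀ i : Σ j, Fin (n j), P[fun ω => g ⟨i.1, X i.1 i.2 ω⟩ / (n i.1 : ℝ)] =
      (∑ m, g ⟨i.1, m⟩ * p ⟨i.1, m⟩) / n i.1 := by
    intro i
    rw [integral_comp_outcome (hXm i.1 i.2) fun m => g ⟨i.1, m⟩ / (n i.1 : ℝ), Finset.sum_div]
    refine Finset.sum_congr rfl fun m _ => ?_
    rw [hXlaw]; ring
  have hsum : ∀ ω, ∑ i, g i * (freqVec (fun j q => X j q ω) i - p i) =
      ∑ i : (Σ j, Fin (n j)), (g ⟨i.1, X i.1 i.2 ω⟩ / (n i.1 : ℝ) -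
        P[fun ω => g ⟨i.1, X i.1 i.2 ω⟩ / (n i.1 : ℝ)]) := by
    intro ω
    simp only [hint]
    rw [Finset.sum_sub_distrib, ← sum_mul_freqVec g fun j q => X j q ω]
    simp only [mul_sub, Finset.sum_sub_distrib]
    congr 1
    rw [Fintype.sum_sigma, Fintype.sum_sigma]
    refine Finset.sum_congr rfl fun j _ => ?_
    have hnj : (n j : ℝ) ≠ 0 := by exact_mod_cast (hn j).ne'
    change _ = ∑ _q : Fin (n j), (∑ m, g ⟨j, m⟩ * p ⟨j, m⟩) / (n j : ℝ)
    rw [Finset.sum_const, Finset.card_univ, Fintype.card_fin, nsmul_eq_mul, mul_div_cancel₀ _ hnj]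
  have hden : ∑ i : (Σ j, Fin (n j)),
      ((⨆ m, g ⟨i.1, m⟩) / (n i.1 : ℝ) - (⨅ m, g ⟨i.1, m⟩) / (n i.1 : ℝ)) ^ 2 =
      ∑ j, ((⨆ m, g ⟨j, m⟩) - ⨅ m, g ⟨j, m⟩) ^ 2 / n j := by
    rw [Fintype.sum_sigma]
    refine Finset.sum_congr rfl fun j _ => ?_
    have : (n j : ℝ) ≠ 0 := by exact_mod_cast (hn j).ne'
    simp only [Finset.sum_const, Finset.card_univ, Fintype.card_fin, nsmul_eq_mul]
    field_simp
  rw [hden] at h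
  simpa only [hsum] using h

end Hoeffding

/-! ### Constants, union bound and comparison with ENM -/

section ConfidenceLevel

variable {d J : ℕ} {M n : Fin J → ℕ}

lemma cCoeff_eq (A : Matrix (Outcome M) (Fin (d ^ 2 - 1)) ℝ) (α : Fin (d ^ 2 - 1)) :
    cCoeff n A α = ((∑ j, n j : ℕ) : ℝ) *
      ∑ j, ((⨆ m, leftInv A α ⟨j, m⟩) - ⨅ m, leftInv A α ⟨j, m⟩) ^ 2 / n j := by
  rw [cCoeff, Finset.mul_sum]
  refine Finset.sum_congr rfl fun j _ => ?_
  ring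

lemma cCoeff_nonneg (A : Matrix (Outcome M) (Fin (d ^ 2 - 1)) ℝ) (α : Fin (d ^ 2 - 1)) :
    0 ≤ cCoeff n A α := by
  unfold cCoeff; positivity

lemma Loss.b_nonneg (L : Loss) (hd : 0 < d) : 0 ≤ L.b d := by
  have h : (0:ℝ) ≤ (d:ℝ) ^ 2 - 1 := by
    have : (1:ℝ) ≤ d := by exact_mod_cast hd
    nlinarith
  cases L <;> simp only [Loss.b] <;> positivity

lemma lossConst_pos (L : Loss) (hd : 0 < d) : 0 < lossConst d L := by
  have : (0:ℝ) < d := by exact_mod_cast hd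
  cases L <;> simp only [lossConst] <;> positivity

/-- The 2 is Hoeffding's, and d² - 1 comes from passing from the norm to one coordinate. For d = 1
both sides are 0 through division by zero. -/
lemma Loss.b_eq (L : Loss) (hd : 0 < d) :
    L.b d = 2 / (lossConst d L ^ 2 * ((d ^ 2 - 1 : ℕ) : ℝ)) := by
  have h1 : (0:ℝ) < d := by exact_mod_cast hd
  have h2 : ((d ^ 2 - 1 : ℕ) : ℝ) = (d:ℝ) ^ 2 - 1 := by
    rw [Nat.cast_sub (Nat.one_le_pow _ _ hd)]; push_cast; ring
  rw [h2]
  cases L <;> simp only [Loss.b, lossConst]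
  · rw [div_mul_eq_div_div]; norm_num
  all_goals
    rw [Real.sq_sqrt (by positivity), div_mul_eq_div_div, div_mul_eq_div_div]
    congr 1; field_simp; norm_num

lemma confLevelCLS_le_confLevelENM (L : Loss) (hd : 0 < d)
    (E : (j : Fin J) → Fin (M j) → Matrix (Fin d) (Fin d) ℂ)
    (l : Fin (d ^ 2 - 1) → Matrix (Fin d) (Fin d) ℂ) (δ : ℝ) :
    confLevelCLS L n E l δ ≤ confLevelENM L n E l δ := by
  have hr0 : 0 ≤ normMin (designMatrix E l) / normMax (designMatrix E l) :=
    div_nonneg normMin_nonneg normMax_nonneg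
  have hr1 : normMin (designMatrix E l) / normMax (designMatrix E l) ≤ 1 :=
    div_le_one_of_le₀ normMin_le_normMax normMax_nonneg
  unfold confLevelCLS confLevelENM
  gcongr with α
  refine mul_le_of_le_one_left (div_nonneg (L.b_nonneg hd) (cCoeff_nonneg _ _)) ?_
  exact pow_le_one₀ hr0 hr1

lemma EuclideanSpace.exists_le_abs_of_le_norm {k : ℕ} (z : EuclideanSpace ℝ (Fin k)) {s : ℝ}
    (hk : 0 < k) (hs : 0 ≤ s) (h : s ≤ ‖z‖) : ∃ α, s / Real.sqrt k ≤ |z α| := by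
  by_contra! hlt
  have hk' : (0:ℝ) < k := by exact_mod_cast hk
  have : Nonempty (Fin k) := ⟨⟨0, hk⟩⟩
  have hsum : ∑ α, z α ^ 2 < ∑ _α : Fin k, (s / Real.sqrt k) ^ 2 :=
    Finset.sum_lt_sum_of_nonempty Finset.univ_nonempty fun α _ => by
      rw [← sq_abs]
      exact pow_lt_pow_left₀ (hlt α) (abs_nonneg _) two_ne_zero
  have h2 : s ^ 2 ≤ ∑ α, z α ^ 2 := by
    rw [← EuclideanSpace.real_norm_sq_eq]
    exact pow_le_pow_left₀ hs h 2
  rw [Finset.sum_const, Finset.card_univ, Fintype.card_fin, nsmul_eq_mul, div_pow,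
    Real.sq_sqrt hk'.le, mul_div_cancel₀ _ hk'.ne'] at hsum
  linarith

lemma IsDensityMatrix.dim_pos {ρ : Matrix (Fin d) (Fin d) ℂ} (hρ : IsDensityMatrix ρ) : 0 < d := by
  rcases Nat.eq_zero_or_pos d with rfl | h
  · simpa [Matrix.trace] using hρ.2
  · exact h

lemma confLevelCLS_le_measureReal
    {E : (j : Fin J) → Fin (M j) → Matrix (Fin d) (Fin d) ℂ} (hIC : IsInformationallyComplete E)
    {l : Fin (d ^ 2 - 1) → Matrix (Fin d) (Fin d) ℂ} (hl : IsBlochBasis l)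
    {ρ : Matrix (Fin d) (Fin d) ℂ} (hρ : IsDensityMatrix ρ) (hn : ∀ j, 0 < n j)
    {δ : ℝ} (hδ : 0 < δ)
    {Ω : Type*} [MeasurableSpace Ω] {P : Measure Ω} [IsProbabilityMeasure P]
    {X : (j : Fin J) → Fin (n j) → Ω → Fin (M j)} (hXm : ∀ j q, Measurable (X j q))
    (hXi : iIndepFun (fun (i : Σ j : Fin J, Fin (n j)) => X i.1 i.2) P)
    (hXlaw : ∀ j q m, P.real {ω | X j q ω = m} = born (E j m) ρ) (L : Loss)
    {ρCLS : EuclideanSpace ℝ (Outcome M) → Matrix (Fin d) (Fin d) ℂ}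
    (hCLS : ∀ f, IsCLSEstimate E f (ρCLS f)) :
    confLevelCLS L n E l δ ≤
      P.real {ω | L.val (ρCLS (freqVec fun j q => X j q ω)) ρ ≤ δ} := by
  have hd := hρ.dim_pos
  set A := designMatrix E l with hA
  set r := normMin A / normMax A with hr
  have hr0 : 0 ≤ r := div_nonneg normMin_nonneg normMax_nonneg
  have hK := lossConst_pos L hd
  set K := lossConst d L
  set t := r * δ / K / Real.sqrt ((d ^ 2 - 1 : ℕ) : ℝ) with ht
  have ht0 : 0 ≤ t := by positivity
  let Z : Fin (d ^ 2 - 1) → Ω → ℝ := fun α ω =>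
    ∑ i, leftInv A α i * (freqVec (fun j q => X j q ω) i - probVec E ρ i)
  set G := {ω | L.val (ρCLS (freqVec fun j q => X j q ω)) ρ ≤ δ}
  have hbad : Gᶜ ⊆ ⋃ α, {ω | t ≤ |Z α ω|} := by
    intro ω hω
    set f := freqVec fun j q => X j q ω
    have hval : δ < L.val (ρCLS f) ρ := not_le.1 hω
    have hD := (hCLS f).1.1.1.sub hρ.1.1
    have h0 : (ρCLS f - ρ).trace = 0 := by rw [Matrix.trace_sub, (hCLS f).1.2, hρ.2, sub_self]
    have h1 := L.val_le (hCLS f).1 hρ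
    rw [hl.norm_bloch hD h0] at h1
    have h2 : δ / K < ‖bloch l (ρCLS f - ρ)‖ := by
      rw [div_lt_iff₀' hK]; exact hval.trans_le h1
    -- For d = 1 the Bloch space is trivial, so a loss above δ cannot occur.
    have hk : 0 < d ^ 2 - 1 := by
      rcases Nat.eq_zero_or_pos (d ^ 2 - 1) with h | h
      · exfalso
        have : IsEmpty (Fin (d ^ 2 - 1)) := by rw [h]; infer_instance
        rw [Subsingleton.elim (bloch l (ρCLS f - ρ)) 0, norm_zero] at h2
        exact absurd h2 (not_lt.2 (by positivity))
      · exact h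
    have h3 : r * δ / K ≤ ‖(WithLp.toLp 2 ((leftInv A).mulVec (f - probVec E ρ).ofLp) :
        EuclideanSpace ℝ (Fin (d ^ 2 - 1)))‖ := by
      rw [mul_div_assoc]
      exact (mul_le_mul_of_nonneg_left h2.le hr0).trans ((hCLS f).ratio_mul_norm_le hIC hl hρ)
    obtain ⟨α, hα⟩ := EuclideanSpace.exists_le_abs_of_le_norm _ hk (by positivity) h3
    exact Set.mem_iUnion.2 ⟨α, hα⟩
  have htail : ∀ α, P.real {ω | t ≤ |Z α ω|} ≤
      2 * Real.exp (-(r ^ 2 * (L.b d / cCoeff n A α) * δ ^ 2 * ((∑ j, n j : ℕ) : ℝ))) := by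
    intro α
    have h := measureReal_abs_freq_ge_le hn (p := fun i => probVec E ρ i) hXm hXi hXlaw
      (leftInv A α) ht0
    refine h.trans (le_of_eq ?_)
    congr 3
    -- The factor N in `cCoeff` must cancel. An empty family of POVMs would force ρ = 0,
    -- contradicting trace one.
    have hN : ((∑ j, n j : ℕ) : ℝ) ≠ 0 := by
      have hJ : J ≠ 0 := by
        rintro rfl
        have h1 := hIC.eq_zero hρ.1.1 fun j => j.elim0
        simpa [h1] using hρ.2
      have : 0 < ∑ j, n j := Finset.sum_pos (fun j _ => hn j)
        ⟨⟨0, Nat.pos_of_ne_zero hJ⟩, Finset.mem_univ _⟩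
      exact_mod_cast this.ne'
    rw [cCoeff_eq, L.b_eq hd, ht, div_pow, Real.sq_sqrt (Nat.cast_nonneg _)]
    change _ = r ^ 2 * (2 / (K ^ 2 * _) / _) * δ ^ 2 * _
    generalize ((d ^ 2 - 1 : ℕ) : ℝ) = k
    generalize (∑ j, ((⨆ m, leftInv A α ⟨j, m⟩) - ⨅ m, leftInv A α ⟨j, m⟩) ^ 2 / (n j : ℝ)) = S
    field_simp
  have h1 : P.real Gᶜ ≤ 2 * ∑ α,
      Real.exp (-(r ^ 2 * (L.b d / cCoeff n A α) * δ ^ 2 * ((∑ j, n j : ℕ) : ℝ))) := by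
    rw [Finset.mul_sum]
    exact (measureReal_mono hbad).trans ((measureReal_iUnion_fintype_le _).trans
      (Finset.sum_le_sum fun α _ => htail α))
  -- Subadditivity suffices here, so measurability of `G` is not needed.
  have h2 : 1 ≤ P.real G + P.real Gᶜ := by
    have := measureReal_union_le (μ := P) G Gᶜ
    rwa [Set.union_compl_self, probReal_univ] at this
  unfold confLevelCLS
  linarith

end ConfidenceLevel

end QTomo

theorem theorem2 {d J : ℕ} {M : Fin J → ℕ}
    -- the informationally complete family of POVMs
    (E : (j : Fin J) → Fin (M j) → Matrix (Fin d) (Fin d) ℂ)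
    (hE : ∀ j, QTomo.IsPOVM (E j)) (hIC : QTomo.IsInformationallyComplete E)
    -- the matrices of the Bloch parametrization
    (l : Fin (d ^ 2 - 1) → Matrix (Fin d) (Fin d) ℂ) (hl : QTomo.IsBlochBasis l)
    -- the true state, the numbers of trials, the threshold
    (ρ : Matrix (Fin d) (Fin d) ℂ) (hρ : QTomo.IsDensityMatrix ρ)
    (n : Fin J → ℕ) (hn : ∀ j, 0 < n j) (δ : ℝ) (hδ : 0 < δ)
    -- independent outcomes of all trials, distributed by the Born rule
    {Ω : Type*} [MeasurableSpace Ω] (P : Measure Ω) [IsProbabilityMeasure P]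
    (X : (j : Fin J) → Fin (n j) → Ω → Fin (M j))
    (hXm : ∀ j q, Measurable (X j q))
    (hXi : iIndepFun (fun (i : Σ j : Fin J, Fin (n j)) => X i.1 i.2) P)
    (hXlaw : ∀ j q m, P.real {ω | X j q ω = m} = QTomo.born (E j m) ρ)
    -- the loss function
    (L : QTomo.Loss) :
    -- the constrained least-squares estimate exists and is unique
    (∀ f : EuclideanSpace ℝ (QTomo.Outcome M), ∃! ρ', QTomo.IsCLSEstimate E f ρ') ∧
    -- the confidence level of the constrained least-squares estimator
    (∀ ρCLS : EuclideanSpace ℝ (QTomo.Outcome M) → Matrix (Fin d) (Fin d) ℂ,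
      (∀ f, QTomo.IsCLSEstimate E f (ρCLS f)) →
        QTomo.confLevelCLS L n E l δ ≤
          P.real {ω | L.val (ρCLS (QTomo.freqVec fun j q => X j q ω)) ρ ≤ δ}) ∧
    -- comparison with the bound for the extended norm-minimization estimator
    QTomo.confLevelCLS L n E l δ ≤ QTomo.confLevelENM L n E l δ := by
  exact ⟨QTomo.existsUnique_isCLSEstimate hIC hρ,
    fun _ hCLS => QTomo.confLevelCLS_le_measureReal hIC hl hρ hn hδ hXm hXi hXlaw L hCLS,
    QTomo.confLevelCLS_le_confLevelENM L hρ.dim_pos E l δ⟩
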